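/- **Setting.** Let $n\ge 0$ and $I,N\ge 1$ be integers, $\delta>0$, $\epsilon\in(0,1)$, $\eta_1,\eta_2\in\{0,1\}$ with $\eta_1+\eta_2\ge 1$, $\boldsymbol B_i\in\mathbb R^n$, $b^i\in\mathbb R$ for $i\in[I]$, and samples $\boldsymbol\zeta_i^j\in\mathbb R^{n+1}$ for $i\in[I],j\in[N]$. Put $\boldsymbol a(\boldsymbol x)=(\eta_1\boldsymbol x,\eta_2)\in\mathbb R^{n+1}$ and $b_i(\boldsymbol x)=\boldsymbol B_i^\top\boldsymbol x+b^i$. Let $\boldsymbol r_{ij},\boldsymbol t_{ij}\in\mathbb R^n_+$ and $u_{ij}\in\mathbb R$ be any coefficients such that $$b_i(\boldsymbol x)-\boldsymbol a(\boldsymbol x)^\top\boldsymbol\zeta_i^j=\boldsymbol r_{ij}^\top\boldsymbol x+\boldsymbol t_{ij}^\top\boldsymbol w+u_{ij}\quad\text{whenever } w_l+x_l=1\ \ \forall l\in[n]$$ (such coefficients always exist). Let $\|\cdot\|$ be the $L_p$ norm, $p\in[1,\infty]$, and $\|\boldsymbol c\|_*=\sup\{\boldsymbol c^\top\boldsymbol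 y:\|\boldsymbol y\|\le1\}$ its dual norm on $\mathbb R^{n+1}$. Let $\widehat Z_1$ be the set of $\boldsymbol x\in\mathbb R^n$ for which there are $\nu,\gamma\in\mathbb R$, $\boldsymbol z\in\mathbb R^N$, $\boldsymbol w\in\mathbb R^n$ with $$\delta\nu-\epsilon\gamma\le\tfrac1N\sum_{j\in[N]}z_j,\qquad -\max\{\boldsymbol r_{ij}^\top\boldsymbol x+\boldsymbol t_{ij}^\top\boldsymbol w+u_{ij},0\}\le -z_j-\gamma\ \ \forall i\in[I],j\in[N],\qquad z_j\le0\ \ \forall j\in[N],$$ $$\|(\eta_1\boldsymbol x,\eta_2)\|_*\le\nu,\qquad w_l+x_l=1\ \ \forall l\in[n],\qquad \nu\ge1,\ \gamma\ge0,\ \boldsymbol w\in\{0,1\}^n.$$ For a function $f$ and $m\ge0$ let $\Pi_f=\{(\boldsymbol y,\phi):f(\boldsymbol y)\le\phi,\ \boldsymbol y\in\{0,1\}^m\}$. Let $\Pi_{ij}=\Pi_{f_{ij}}$ with $m=2n$ and $f_{ij}(\boldsymbol x,\boldsymbol w)=-\max\{\boldsymbol r_{ij}^\top\boldsymbol x+\boldsymbol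 t_{ij}^\top\boldsymbol w+u_{ij},0\}$, and $\Pi_0=\Pi_{f_0}$ with $m=n$ and $f_0(\boldsymbol x)=\|(\eta_1\boldsymbol x,\eta_2)\|_*$. For a permutation $\sigma$ of $[m]$ put $\rho^\sigma_{l}=f(\boldsymbol e_{\{\sigma_1,\dots,\sigma_l\}})-f(\boldsymbol e_{\{\sigma_1,\dots,\sigma_{l-1}\}})$, where $\boldsymbol e_T$ is the $0/1$ incidence vector of $T$; the *extended polymatroid inequality* (EPI) of $f$ and $\sigma$ is $f(\boldsymbol 0)+\sum_{l\in[m]}\rho^\sigma_{l}\,y_{\sigma_l}\le\phi$. **Statement.** Suppose that $S\subseteq\{0,1\}^n$. Then: 1. $S\cap\widehat Z_1$ is the set of all $\boldsymbol x\in S$ for which there are $\nu,\gamma\in\mathbb R$, $\boldsymbol z\in\mathbb R^N$, $\boldsymbol w\in\mathbb R^n$ with $$\delta\nu-\epsilon\gamma\le\tfrac1N\sum_{j\in[N]}z_j,\qquad(\boldsymbol x,\boldsymbol w,-z_j-\gamma)\in\operatorname{conv}(\Pi_{ij})\ \ \forall i\in[I],j\in[N],\qquad z_j\le0\ \ \forall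 j\in[N],$$ $$(\boldsymbol x,\nu)\in\operatorname{conv}(\Pi_0),\qquad w_l+x_l=1\ \ \forall l\in[n],\qquad\nu\ge1,\ \gamma\ge0,\ \boldsymbol w\in[0,1]^n.$$ 2. The functions $f_{ij}$ ($i\in[I]$, $j\in[N]$) and $f_0$ are submodular over the binary hypercube, i.e. $T\mapsto f(\boldsymbol e_T)$ is a submodular set function. 3. For each $f\in\{f_{ij}\}_{i\in[I],j\in[N]}\cup\{f_0\}$, $\operatorname{conv}(\Pi_f)$ is the set of all $(\boldsymbol y,\phi)$ with $\boldsymbol y\in[0,1]^m$ that satisfy the EPIs of all permutations $\sigma$ of $[m]$. 4. For each such $f$ the EPIs are separated greedily: if $\tilde{\boldsymbol y}\in[0,1]^m$, $(\tilde{\boldsymbol y},\tilde\phi)\notin\operatorname{conv}(\Pi_f)$ and $\sigma$ is any permutation with $\tilde y_{\sigma_1}\ge\dots\ge\tilde y_{\sigma_m}$, then the EPI of $\sigma$ is violated by $(\tilde{\boldsymbol y},\tilde\phi)$ and is satisfied by all points of $\operatorname{conv}(\Pi_f)$. -/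

import Mathlib

noncomputable section

/-! ### Submodular functions on the binary hypercube and extended polymatroid inequalities -/

section Polymatroid

variable {ι : Type*} [Fintype ι] [DecidableEq ι]

/-- The `0/1` incidence vector `e_T` of a subset `T` of the ground set. -/
def incidence (T : Finset ι) : ι → ℝ := fun l => if l ∈ T then 1 else 0

/-- A set function is submodular if it has diminishing marginal returns. -/
def SubmodularSetFun (g : Finset ι → ℝ) : Prop :=
  ∀ T₁ T₂ : Finset ι, T₁ ⊆ T₂ → ∀ t, t ∉ T₂ →
    g (insert t T₂) - g T₂ ≤ g (insert t T₁) - g T₁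

/-- `f` is submodular over the binary hypercube: `T ↦ f (e_T)` is a submodular set function. -/
def SubmodularOnCube (f : (ι → ℝ) → ℝ) : Prop :=
  SubmodularSetFun fun T : Finset ι => f (incidence T)

/-- The binary hypercube `{0,1}^ι`. -/
def binaryCube (ι : Type*) : Set (ι → ℝ) := {x | ∀ l, x l = 0 ∨ x l = 1}

/-- The unit box `[0,1]^ι`. -/
def unitBox (ι : Type*) : Set (ι → ℝ) := {x | ∀ l, 0 ≤ x l ∧ x l ≤ 1}

/-- The epigraph `{(x, φ) : f x ≤ φ, x ∈ {0,1}^ι}` of `f` over the binary hypercube. -/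
def binaryEpigraph (f : (ι → ℝ) → ℝ) : Set ((ι → ℝ) × ℝ) :=
  {q | f q.1 ≤ q.2 ∧ q.1 ∈ binaryCube ι}

/-- `A_k = {σ_1, …, σ_k}`, the first `k` elements in the order `σ` (positions are counted from
zero in `Fin`, so these are the positions `0, …, k - 1`). -/
def orderPrefix (σ : Fin (Fintype.card ι) ≃ ι) (k : ℕ) : Finset ι :=
  (Finset.univ.filter fun l : Fin (Fintype.card ι) => (l : ℕ) < k).image σ

/-- The marginal value that `f` assigns to the `l`-th element in the order `σ`. -/
def epiCoeff (f : (ι → ℝ) → ℝ) (σ : Fin (Fintype.card ι) ≃ ι) (l : Fin (Fintype.card ι)) : ℝ :=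
  f (incidence (orderPrefix σ ((l : ℕ) + 1))) - f (incidence (orderPrefix σ (l : ℕ)))

/-- The left-hand side of the extended polymatroid inequality of the order `σ`. -/
def epiLHS (f : (ι → ℝ) → ℝ) (σ : Fin (Fintype.card ι) ≃ ι) (x : ι → ℝ) : ℝ :=
  f 0 + ∑ l, epiCoeff f σ l * x (σ l)

/-- The set described by the system of all extended polymatroid inequalities of `f`, together
with the bounds `x ∈ [0,1]^ι`. -/
def epiPolyhedron (f : (ι → ℝ) → ℝ) : Set ((ι → ℝ) × ℝ) :=
  {q | (∀ σ : Fin (Fintype.card ι) ≃ ι, epiLHS f σ q.1 ≤ q.2) ∧ q.1 ∈ unitBox ι}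

/-- The greedy rule separates from the convex hull of the epigraph of `f`: whenever a point
`(x, φ)` with `x ∈ [0,1]^ι` lies outside the convex hull, the single inequality of any order `σ`
that sorts the entries of `x` decreasingly is violated by `(x, φ)`, while it is valid on the
whole convex hull. -/
def GreedilySeparable (f : (ι → ℝ) → ℝ) : Prop :=
  ∀ (x : ι → ℝ) (φ : ℝ), x ∈ unitBox ι → (x, φ) ∉ convexHull ℝ (binaryEpigraph f) →
    ∀ σ : Fin (Fintype.card ι) ≃ ι, Antitone (fun l => x (σ l)) →
      φ < epiLHS f σ x ∧ ∀ q ∈ convexHull ℝ (binaryEpigraph f), epiLHS f σ q.1 ≤ q.2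

end Polymatroid

/-! ### Norms -/

/-- The `L_p` norm on `ℝ^κ`, for `p ∈ [1, ∞]`. -/
def lpNormFun {κ : Type*} [Fintype κ] (p : ENNReal) (y : κ → ℝ) : ℝ :=
  ‖(WithLp.toLp p y : PiLp p fun _ : κ => ℝ)‖

/-- The dual norm `‖c‖_* = sup {cᵀ y : ‖y‖ ≤ 1}`. -/
def dualNormFun {κ : Type*} [Fintype κ] (nrm : (κ → ℝ) → ℝ) (c : κ → ℝ) : ℝ :=
  sSup {s : ℝ | ∃ y : κ → ℝ, nrm y ≤ 1 ∧ s = ∑ k, c k * y k}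

/-! ### The chance constrained program -/

/-- The data of a distributionally robust chance constraint with decision vector in `ℝ^n`,
`I` uncertain constraints and `N` empirical samples. -/
structure ChanceData (n I N : ℕ) where
  /-- indicator of left-hand side uncertainty -/
  η₁ : ℝ
  /-- indicator of right-hand side uncertainty -/
  η₂ : ℝ
  η₁_binary : η₁ = 0 ∨ η₁ = 1
  η₂_binary : η₂ = 0 ∨ η₂ = 1
  one_le_η : 1 ≤ η₁ + η₂
  /-- the gradients `B_i` of the right-hand sides -/
  B : Fin I → Fin n → ℝ
  /-- the constants `b^i` of the right-hand sides -/
  b₀ : Fin I → ℝ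
  /-- the empirical samples, `ζ j i ∈ ℝ^(n+1)` -/
  ζ : Fin N → Fin I → Fin (n + 1) → ℝ
  /-- the Wasserstein radius -/
  δ : ℝ
  /-- the risk tolerance -/
  ε : ℝ
  I_pos : 0 < I
  N_pos : 0 < N
  δ_pos : 0 < δ
  ε_pos : 0 < ε
  ε_lt_one : ε < 1

namespace ChanceData

variable {n I N : ℕ}

/-- `a(x) = (η₁ x, η₂) ∈ ℝ^(n+1)`. -/
def a (D : ChanceData n I N) (x : Fin n → ℝ) : Fin (n + 1) → ℝ :=
  Fin.snoc (α := fun _ => ℝ) (fun l => D.η₁ * x l) D.η₂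

/-- `b_i(x) = B_iᵀ x + b^i`. -/
def b (D : ChanceData n I N) (i : Fin I) (x : Fin n → ℝ) : ℝ :=
  ∑ l, D.B i l * x l + D.b₀ i

/-- A way to write `b_i(x) - a(x)ᵀ ζ_i^j = r_ijᵀ x + t_ijᵀ w + u_ij` with nonnegative `r_ij`,
`t_ij`, where `w` is the complement of `x`. -/
structure ComplementedForm (D : ChanceData n I N) where
  r : Fin I → Fin N → Fin n → ℝ
  t : Fin I → Fin N → Fin n → ℝ
  u : Fin I → Fin N → ℝ
  r_nonneg : ∀ i j l, 0 ≤ r i j l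
  t_nonneg : ∀ i j l, 0 ≤ t i j l
  eq_slack : ∀ i j (x w : Fin n → ℝ), (∀ l, w l + x l = 1) →
    D.b i x - ∑ k, D.a x k * D.ζ j i k
      = ∑ l, r i j l * x l + ∑ l, t i j l * w l + u i j

/-- The standard choice of the coefficients, obtained by splitting into positive and negative
parts; in particular complemented forms always exist. -/
def standardForm (D : ChanceData n I N) : D.ComplementedForm where
  r i j l := (if 0 < D.B i l then D.B i l else 0)
    - D.η₁ * (if D.ζ j i l.castSucc < 0 then D.ζ j i l.castSucc else 0)
  t i j l := -(if D.B i l < 0 then D.B i l else 0)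
    + D.η₁ * (if 0 < D.ζ j i l.castSucc then D.ζ j i l.castSucc else 0)
  u i j := D.b₀ i - D.η₂ * D.ζ j i (Fin.last n)
    + ∑ l, ((if D.B i l < 0 then D.B i l else 0)
      - D.η₁ * (if 0 < D.ζ j i l.castSucc then D.ζ j i l.castSucc else 0))
  r_nonneg i j l := by
    rcases D.η₁_binary with h | h <;> rw [h] <;> split_ifs <;> linarith
  t_nonneg i j l := by
    rcases D.η₁_binary with h | h <;> rw [h] <;> split_ifs <;> linarith
  eq_slack i j x w hw := by
    have hw' : ∀ l, w l = 1 - x l := fun l => by linarith [hw l]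
    have key : ∀ l : Fin n, D.B i l * x l - D.η₁ * x l * D.ζ j i l.castSucc
        = ((if 0 < D.B i l then D.B i l else 0)
            - D.η₁ * (if D.ζ j i l.castSucc < 0 then D.ζ j i l.castSucc else 0)) * x l
          + (-(if D.B i l < 0 then D.B i l else 0)
            + D.η₁ * (if 0 < D.ζ j i l.castSucc then D.ζ j i l.castSucc else 0)) * w l
          + ((if D.B i l < 0 then D.B i l else 0)
            - D.η₁ * (if 0 < D.ζ j i l.castSucc then D.ζ j i l.castSucc else 0)) := by
      intro l
      rw [hw' l]
      rcases lt_trichotomy (D.B i l) 0 with h1 | h1 | h1 <;>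
      rcases lt_trichotomy (D.ζ j i l.castSucc) 0 with h2 | h2 | h2 <;>
      simp [h1, h2, not_lt.mpr h1.le, not_lt.mpr h2.le] <;> ring
    have hsum := Finset.sum_congr (rfl : (Finset.univ : Finset (Fin n)) = Finset.univ)
      (fun l _ => key l)
    rw [Finset.sum_sub_distrib, Finset.sum_add_distrib, Finset.sum_add_distrib] at hsum
    simp only [b, a, Fin.sum_univ_castSucc, Fin.snoc_castSucc, Fin.snoc_last]
    linarith

/-- The set `Ẑ₁`, for an underlying norm `nrm` on `ℝ^(n+1)`. -/
def Zhat₁ (D : ChanceData n I N) (R : D.ComplementedForm) (nrm : (Fin (n + 1) → ℝ) → ℝ) :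
    Set (Fin n → ℝ) :=
  {x | ∃ (ν γ : ℝ) (z : Fin N → ℝ) (w : Fin n → ℝ),
    D.δ * ν - D.ε * γ ≤ (1 / (N : ℝ)) * ∑ j, z j ∧
    (∀ i j, -max (∑ l, R.r i j l * x l + ∑ l, R.t i j l * w l + R.u i j) 0 ≤ -z j - γ) ∧
    (∀ j, z j ≤ 0) ∧
    dualNormFun nrm (D.a x) ≤ ν ∧
    (∀ l, w l + x l = 1) ∧
    1 ≤ ν ∧ 0 ≤ γ ∧ w ∈ binaryCube (Fin n)}

/-- The function `(x, w) ↦ -max {r_ijᵀ x + t_ijᵀ w + u_ij, 0}`; the pair `(x, w)` is one vector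
indexed by `Fin n ⊕ Fin n`. -/
def slackFun {D : ChanceData n I N} (R : D.ComplementedForm) (i : Fin I) (j : Fin N)
    (y : Fin n ⊕ Fin n → ℝ) : ℝ :=
  -max (∑ l, R.r i j l * y (Sum.inl l) + ∑ l, R.t i j l * y (Sum.inr l) + R.u i j) 0

/-- The function `x ↦ ‖(η₁ x, η₂)‖_*`. -/
def normFun (D : ChanceData n I N) (nrm : (Fin (n + 1) → ℝ) → ℝ) (x : Fin n → ℝ) : ℝ :=
  dualNormFun nrm (D.a x)

/-- `Π_ij = {(x, w, φ) : -max {r_ijᵀ x + t_ijᵀ w + u_ij, 0} ≤ φ, x, w ∈ {0,1}^n}`. -/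
def slackEpigraph {D : ChanceData n I N} (R : D.ComplementedForm) (i : Fin I) (j : Fin N) :
    Set ((Fin n ⊕ Fin n → ℝ) × ℝ) :=
  binaryEpigraph (slackFun R i j)

/-- `Π_0 = {(x, φ) : ‖(η₁ x, η₂)‖_* ≤ φ, x ∈ {0,1}^n}`. -/
def normEpigraph (D : ChanceData n I N) (nrm : (Fin (n + 1) → ℝ) → ℝ) :
    Set ((Fin n → ℝ) × ℝ) :=
  binaryEpigraph (D.normFun nrm)

end ChanceData

end

/-! ### Epigraphs over the cube and extended polymatroid inequalities -/

section Polymatroid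

/-! The reformulation rests on extremality: a vertex of the cube is an extreme point of the unit
box, so for every `f`, submodular or not, the convex hull of the epigraph has the same fibre over a
vertex as the epigraph itself (`mem_convexHull_binaryEpigraph_iff`). Binary `x` forces `w = 1 - x`
to be binary, so passing to hulls changes nothing.

The hull description is Lovász's greedy argument. Diminishing returns, summed along the prefixes of
`σ`, make each inequality valid. Conversely, if `σ` sorts `x` decreasingly, then `x` is a convex
combination of the prefix vectors, and `epiLHS f σ x` is the same combination of the values of `f`
there. So this single inequality decides membership, which also gives greedy separation.

Both families are concave functions of nonnegative modular set functions: `-max(s + u, 0)` of a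
weighted sum `s`, and, when `η₁ = 1`, the dual norm as `k ^ (1 - 1/p)` with `k` the number of ones.
-/

theorem incidence_empty {ι : Type*} [DecidableEq ι] : incidence (∅ : Finset ι) = 0 := by
  ext l; simp [incidence]

theorem incidence_mem_binaryCube {ι : Type*} [DecidableEq ι] (T : Finset ι) :
    incidence T ∈ binaryCube ι := by
  intro l
  by_cases h : l ∈ T <;> simp [incidence, h]

theorem binaryCube_subset_unitBox {ι : Type*} : binaryCube ι ⊆ unitBox ι := by
  intro x hx l
  rcases hx l with h | h <;> rw [h] <;> norm_num

theorem convex_unitBox {ι : Type*} : Convex ℝ (unitBox ι) := by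
  intro y hy z hz a b ha hb hab l
  change 0 ≤ a * y l + b * z l ∧ a * y l + b * z l ≤ 1
  have h1 := mul_nonneg ha (hy l).1
  have h2 := mul_nonneg hb (hz l).1
  have h3 := mul_le_mul_of_nonneg_left (hy l).2 ha
  have h4 := mul_le_mul_of_nonneg_left (hz l).2 hb
  exact ⟨by linarith, by linarith⟩

/-- Over a vertex of the cube the convex hull of the epigraph is the epigraph. -/
theorem mem_convexHull_binaryEpigraph_iff {ι : Type*} (f : (ι → ℝ) → ℝ)
    {x : ι → ℝ} (hx : x ∈ binaryCube ι) (φ : ℝ) :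
    (x, φ) ∈ convexHull ℝ (binaryEpigraph f) ↔ f x ≤ φ := by
  refine ⟨fun h => ?_, fun h => subset_convexHull ℝ _ ⟨h, hx⟩⟩
  -- `C` constrains the height only above `x`; it is convex because `x` is extreme in the box.
  let C : Set ((ι → ℝ) × ℝ) := {q | q.1 ∈ unitBox ι ∧ (q.1 = x → f x ≤ q.2)}
  have hC : Convex ℝ C := by
    -- Strictly positive weights are what force both endpoints to equal `x`.
    rw [convex_iff_forall_pos]
    rintro ⟨y, s⟩ ⟨hy, hys⟩ ⟨z, t⟩ ⟨hz, hzt⟩ a b ha hb hab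
    dsimp only at hy hz hys hzt
    refine ⟨fun l => ?_, fun h => ?_⟩
    · exact convex_unitBox hy hz ha.le hb.le hab l
    · have key : ∀ l, y l = x l ∧ z l = x l := by
        intro l
        have hl : a * y l + b * z l = x l := congrFun h l
        have h1 := hy l
        have h2 := hz l
        rcases hx l with h0 | h0 <;> rw [h0] at hl ⊢
        · have := mul_nonneg ha.le h1.1
          have := mul_nonneg hb.le h2.1
          exact ⟨(mul_eq_zero.1 (by linarith : a * y l = 0)).resolve_left ha.ne',
            (mul_eq_zero.1 (by linarith : b * z l = 0)).resolve_left hb.ne'⟩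
        · have h3 := mul_nonneg ha.le (sub_nonneg.2 h1.2)
          have h4 := mul_nonneg hb.le (sub_nonneg.2 h2.2)
          have h5 : a * (1 - y l) = 0 := by nlinarith
          have h6 : b * (1 - z l) = 0 := by nlinarith
          have h7 := (mul_eq_zero.1 h5).resolve_left ha.ne'
          have h8 := (mul_eq_zero.1 h6).resolve_left hb.ne'
          exact ⟨by linarith, by linarith⟩
      have h1 := mul_le_mul_of_nonneg_left (hys (funext fun l => (key l).1)) ha.le
      have h2 := mul_le_mul_of_nonneg_left (hzt (funext fun l => (key l).2)) hb.le
      have h3 : a * f x + b * f x = f x := by rw [← add_mul, hab, one_mul]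
      change f x ≤ a * s + b * t
      linarith
  have hsub : binaryEpigraph f ⊆ C := by
    rintro ⟨y, s⟩ ⟨hs, hy⟩
    exact ⟨binaryCube_subset_unitBox hy, fun h => h ▸ hs⟩
  exact (convexHull_min hsub hC h).2 rfl

theorem exists_order_antitone {ι : Type*} [Fintype ι] (x : ι → ℝ) :
    ∃ σ : Fin (Fintype.card ι) ≃ ι, Antitone fun l => x (σ l) := by
  let e := (Fintype.equivFin ι).symm
  refine ⟨(Tuple.sort fun l => -x (e l)).trans e, fun k l h => ?_⟩
  have := Tuple.monotone_sort (fun l => -x (e l)) h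
  simpa using this

variable {ι : Type*} [Fintype ι] [DecidableEq ι]

theorem exists_eq_incidence {x : ι → ℝ} (hx : x ∈ binaryCube ι) : ∃ T, x = incidence T := by
  refine ⟨Finset.univ.filter fun l => x l = 1, ?_⟩
  ext l
  rcases hx l with h | h <;> simp [incidence, h]

theorem orderPrefix_zero (σ : Fin (Fintype.card ι) ≃ ι) : orderPrefix σ 0 = ∅ := by
  simp [orderPrefix]

theorem mem_orderPrefix (σ : Fin (Fintype.card ι) ≃ ι) (k : ℕ) (a : ι) :
    a ∈ orderPrefix σ k ↔ (σ.symm a : ℕ) < k := by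
  simp only [orderPrefix, Finset.mem_image, Finset.mem_filter, Finset.mem_univ, true_and]
  constructor
  · rintro ⟨l, hl, rfl⟩; simpa using hl
  · intro h; exact ⟨σ.symm a, h, by simp⟩

theorem orderPrefix_succ (σ : Fin (Fintype.card ι) ≃ ι) (l : Fin (Fintype.card ι)) :
    orderPrefix σ (l + 1) = insert (σ l) (orderPrefix σ l) := by
  ext a
  rw [Finset.mem_insert, mem_orderPrefix, mem_orderPrefix, ← σ.symm_apply_eq, Fin.ext_iff]
  omega

theorem notMem_orderPrefix (σ : Fin (Fintype.card ι) ≃ ι) (l : Fin (Fintype.card ι)) :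
    σ l ∉ orderPrefix σ l := by
  simp [mem_orderPrefix]

theorem orderPrefix_card (σ : Fin (Fintype.card ι) ≃ ι) :
    orderPrefix σ (Fintype.card ι) = Finset.univ := by
  ext a
  simp [mem_orderPrefix]

/-- Extended polymatroid inequalities of a submodular function hold on its epigraph. -/
theorem SubmodularOnCube.epiLHS_incidence_le {f : (ι → ℝ) → ℝ} (hf : SubmodularOnCube f)
    (σ : Fin (Fintype.card ι) ≃ ι) (T : Finset ι) :
    epiLHS f σ (incidence T) ≤ f (incidence T) := by
  -- Telescoping along `T ∩ A_k`: adding `σ l ∈ T` gains at least as much here as it does on the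
  -- larger set `A_l`.
  set G : ℕ → ℝ := fun k => f (incidence (T ∩ orderPrefix σ k)) with hG
  have step : ∀ l : Fin (Fintype.card ι),
      epiCoeff f σ l * incidence T (σ l) ≤ G (l + 1) - G l := by
    intro l
    by_cases h : σ l ∈ T
    · have h1 : incidence T (σ l) = 1 := by simp [incidence, h]
      have h2 := hf (T ∩ orderPrefix σ l) (orderPrefix σ l) Finset.inter_subset_right (σ l)
        (notMem_orderPrefix σ l)
      rw [h1, mul_one, epiCoeff]
      simp only [hG]
      rw [orderPrefix_succ, Finset.inter_insert_of_mem h]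
      exact h2
    · have h1 : incidence T (σ l) = 0 := by simp [incidence, h]
      rw [h1, mul_zero]
      simp only [hG]
      rw [orderPrefix_succ, Finset.inter_insert_of_notMem h, sub_self]
  have hsum : ∑ l, epiCoeff f σ l * incidence T (σ l)
      ≤ ∑ l : Fin (Fintype.card ι), (G (l + 1) - G l) := Finset.sum_le_sum fun l _ => step l
  rw [← Finset.sum_range (fun k => G (k + 1) - G k), Finset.sum_range_sub] at hsum
  simp only [hG, orderPrefix_zero, orderPrefix_card, Finset.inter_empty, Finset.inter_univ,
    incidence_empty] at hsum
  rw [epiLHS]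
  linarith

theorem convex_epiPolyhedron (f : (ι → ℝ) → ℝ) : Convex ℝ (epiPolyhedron f) := by
  rintro ⟨x, φ⟩ ⟨hx, hx'⟩ ⟨y, ψ⟩ ⟨hy, hy'⟩ a b ha hb hab
  refine ⟨fun σ => ?_, fun l => ?_⟩
  · have h : epiLHS f σ (a • x + b • y) = a * epiLHS f σ x + b * epiLHS f σ y := by
      simp only [epiLHS, Pi.add_apply, Pi.smul_apply, smul_eq_mul, mul_add, Finset.mul_sum,
        Finset.sum_add_distrib]
      have h0 : f 0 = a * f 0 + b * f 0 := by rw [← add_mul, hab, one_mul]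
      have h1 : ∀ (c : ℝ) (z : ι → ℝ), ∑ l, epiCoeff f σ l * (c * z (σ l))
          = ∑ l, c * (epiCoeff f σ l * z (σ l)) := fun c z =>
        Finset.sum_congr rfl fun l _ => by ring
      rw [h1, h1]
      linarith
    have h1 := mul_le_mul_of_nonneg_left (hx σ) ha
    have h2 := mul_le_mul_of_nonneg_left (hy σ) hb
    change epiLHS f σ (a • x + b • y) ≤ a * φ + b * ψ
    rw [h]
    exact add_le_add h1 h2
  · exact convex_unitBox hx' hy' ha hb hab l

theorem SubmodularOnCube.convexHull_subset {f : (ι → ℝ) → ℝ} (hf : SubmodularOnCube f) :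
    convexHull ℝ (binaryEpigraph f) ⊆ epiPolyhedron f := by
  refine convexHull_min ?_ (convex_epiPolyhedron f)
  rintro ⟨x, φ⟩ ⟨hφ, hx⟩
  refine ⟨fun σ => ?_, binaryCube_subset_unitBox hx⟩
  obtain ⟨T, rfl⟩ := exists_eq_incidence hx
  exact (hf.epiLHS_incidence_le σ T).trans hφ

/-- Abel summation: trades weights on prefixes for weights on marginal values. -/
theorem sum_sub_succ_mul (c g : ℕ → ℝ) (M : ℕ) :
    ∑ k ∈ Finset.range (M + 1), (c k - c (k + 1)) * g k
      = c 0 * g 0 - c (M + 1) * g M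
        + ∑ k ∈ Finset.range M, c (k + 1) * (g (k + 1) - g k) := by
  induction M with
  | zero => simp; ring
  | succ M ih =>
    rw [Finset.sum_range_succ, ih, Finset.sum_range_succ _ M]
    ring

/-- A point of the box on or above the extended polymatroid inequality of an order that sorts its
entries decreasingly is in the convex hull of the epigraph. -/
theorem mem_convexHull_of_epiLHS_le (f : (ι → ℝ) → ℝ) {x : ι → ℝ} (hx : x ∈ unitBox ι)
    {σ : Fin (Fintype.card ι) ≃ ι} (hσ : Antitone fun l => x (σ l)) {φ : ℝ}
    (hφ : epiLHS f σ x ≤ φ) : (x, φ) ∈ convexHull ℝ (binaryEpigraph f) := by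
  -- The sorted entries of `x`, padded by 1 in front and 0 behind. The drops `c k - c (k + 1)` are
  -- then nonnegative and sum to 1.
  let c : ℕ → ℝ := fun k =>
    k.casesOn 1 fun k => if h : k < Fintype.card ι then x (σ ⟨k, h⟩) else 0
  have c0 : c 0 = 1 := rfl
  have cs : ∀ l : Fin (Fintype.card ι), c (l + 1) = x (σ l) := fun l => by simp [c]
  have cm : c (Fintype.card ι + 1) = 0 := by simp [c]
  have hnonneg : ∀ k ∈ Finset.range (Fintype.card ι + 1), 0 ≤ c k - c (k + 1) := by
    intro k _
    rcases k with _ | k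
    · simp only [c]
      split_ifs with h
      · linarith [(hx (σ ⟨0, h⟩)).2]
      · norm_num
    · simp only [c]
      split_ifs with h1 h2 h2
      · exact sub_nonneg.2 (hσ (Fin.mk_le_mk.2 (Nat.le_succ k)))
      · linarith [(hx (σ ⟨k, h1⟩)).1]
      · omega
      · norm_num
  have hone : ∑ k ∈ Finset.range (Fintype.card ι + 1), (c k - c (k + 1)) = 1 := by
    rw [Finset.sum_range_sub', c0, cm, sub_zero]
  have abel : ∀ g : ℕ → ℝ, ∑ k ∈ Finset.range (Fintype.card ι + 1), (c k - c (k + 1)) * g k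
      = g 0 + ∑ l : Fin (Fintype.card ι), x (σ l) * (g (l + 1) - g l) := by
    intro g
    rw [sum_sub_succ_mul, c0, cm, Finset.sum_range]
    simp only [cs]
    ring
  -- Every prefix point is raised by the same slack, so the combination has height exactly `φ`.
  have hmem := (convex_convexHull ℝ (binaryEpigraph f)).sum_mem hnonneg hone
    (z := fun k => (incidence (orderPrefix σ k),
      f (incidence (orderPrefix σ k)) + (φ - epiLHS f σ x)))
    (fun k _ => subset_convexHull ℝ _
      ⟨by simpa using hφ, incidence_mem_binaryCube _⟩)
  convert hmem using 1
  refine Prod.ext ?_ ?_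
  · ext a
    simp only [Prod.fst_sum, Finset.sum_apply, Prod.smul_mk, Pi.smul_apply, smul_eq_mul]
    rw [abel fun k => incidence (orderPrefix σ k) a]
    -- Membership of `a` in the prefixes changes only at the position of `a`.
    rw [Finset.sum_eq_single (σ.symm a)]
    · simp [incidence, mem_orderPrefix]
    · intro l _ hl
      have : σ.symm a ≠ l := fun h => hl h.symm
      have h1 : (a ∈ orderPrefix σ (l + 1)) ↔ a ∈ orderPrefix σ l := by
        rw [mem_orderPrefix, mem_orderPrefix]
        have := fun h => this (Fin.ext h)
        omega
      simp [incidence, h1]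
    · simp
  · simp only [Prod.snd_sum, Prod.smul_mk, smul_eq_mul, mul_add, Finset.sum_add_distrib]
    rw [abel fun k => f (incidence (orderPrefix σ k)), ← Finset.sum_mul, hone, one_mul]
    have : epiLHS f σ x = f (incidence (orderPrefix σ 0)) + ∑ l : Fin (Fintype.card ι), x (σ l) *
        (f (incidence (orderPrefix σ (l + 1))) - f (incidence (orderPrefix σ l))) := by
      rw [epiLHS, orderPrefix_zero, incidence_empty]
      congr 1
      exact Finset.sum_congr rfl fun l _ => by rw [epiCoeff, mul_comm]
    linarith

theorem SubmodularOnCube.convexHull_eq {f : (ι → ℝ) → ℝ} (hf : SubmodularOnCube f) :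
    convexHull ℝ (binaryEpigraph f) = epiPolyhedron f := by
  refine hf.convexHull_subset.antisymm ?_
  rintro ⟨x, φ⟩ ⟨h, hx⟩
  obtain ⟨σ, hσ⟩ := exists_order_antitone x
  exact mem_convexHull_of_epiLHS_le f hx hσ (h σ)

theorem SubmodularOnCube.greedilySeparable {f : (ι → ℝ) → ℝ} (hf : SubmodularOnCube f) :
    GreedilySeparable f := fun _ _ hx hmem σ hσ =>
  ⟨not_le.1 fun h => hmem (mem_convexHull_of_epiLHS_le f hx hσ h),
    fun _ hq => (hf.convexHull_subset hq).1 σ⟩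

end Polymatroid

/-! ### The dual `L_p` norm of 0/1 vectors -/

section DualNorm

/-- Hölder against an indicator, by the power mean inequality. For `p = ⊤`, `toReal` is 0 with
inverse 0, so the exponent is correctly 1. -/
theorem sum_le_rpow_card_mul_lpNormFun {κ : Type*} [Fintype κ] {p : ENNReal}
    (hp : 1 ≤ p) (U : Finset κ) (y : κ → ℝ)
    (hU : U.Nonempty) :
    ∑ k ∈ U, y k ≤ (U.card : ℝ) ^ (1 - (p.toReal)⁻¹) * lpNormFun p y := by
  have hcard : (0 : ℝ) < U.card := by exact_mod_cast hU.card_pos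
  rcases eq_or_ne p ⊤ with rfl | htop
  · simp only [ENNReal.toReal_top, inv_zero, sub_zero, Real.rpow_one]
    calc ∑ k ∈ U, y k ≤ ∑ _k ∈ U, lpNormFun ⊤ y := by
          refine Finset.sum_le_sum fun k _ => (le_abs_self _).trans ?_
          exact PiLp.norm_apply_le (WithLp.toLp ⊤ y : PiLp ⊤ fun _ : κ => ℝ) k
      _ = _ := by simp
  · have hp1 : 1 ≤ p.toReal := by
      rw [← ENNReal.toReal_one]; exact ENNReal.toReal_mono htop hp
    have hp0 : 0 < p.toReal := by linarith
    have hnorm : lpNormFun p y = (∑ k, |y k| ^ p.toReal) ^ (p.toReal)⁻¹ := by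
      rw [lpNormFun, PiLp.norm_eq_sum hp0]
      simp
    have h1 := Real.rpow_sum_le_const_mul_sum_rpow U y hp1
    have h2 : ∑ k ∈ U, |y k| ^ p.toReal ≤ ∑ k, |y k| ^ p.toReal :=
      Finset.sum_le_sum_of_subset_of_nonneg (Finset.subset_univ _) fun _ _ _ => by positivity
    have h3 : (∑ k ∈ U, |y k|) ^ p.toReal
        ≤ (U.card : ℝ) ^ (p.toReal - 1) * ∑ k, |y k| ^ p.toReal :=
      h1.trans (mul_le_mul_of_nonneg_left h2 (by positivity))
    have h4 : ∑ k ∈ U, |y k|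
        ≤ ((U.card : ℝ) ^ (p.toReal - 1) * ∑ k, |y k| ^ p.toReal) ^ (p.toReal)⁻¹ :=
      (Real.le_rpow_inv_iff_of_pos (by positivity) (by positivity) hp0).2 h3
    rw [Real.mul_rpow (by positivity) (by positivity), ← Real.rpow_mul hcard.le, ← hnorm,
      sub_mul, mul_inv_cancel₀ hp0.ne', one_mul] at h4
    exact (Finset.sum_le_sum fun k _ => le_abs_self _).trans h4

variable {κ : Type*} [Fintype κ] [DecidableEq κ]

/-- This multiple of the indicator attains equality in the Hölder bound, so the supremum in the dual
norm is a maximum. -/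
theorem lpNormFun_smul_incidence_le {p : ENNReal} (hp : 1 ≤ p) (U : Finset κ)
    (hU : U.Nonempty) :
    lpNormFun p (fun k => (U.card : ℝ) ^ (-(p.toReal)⁻¹) * incidence U k) ≤ 1 := by
  have hcard : (0 : ℝ) < U.card := by exact_mod_cast hU.card_pos
  rcases eq_or_ne p ⊤ with rfl | htop
  · rw [lpNormFun, PiLp.norm_eq_ciSup]
    have : Nonempty κ := ⟨hU.choose⟩
    refine ciSup_le fun k => ?_
    by_cases h : k ∈ U <;> simp [incidence, h]
  · have hp1 : 1 ≤ p.toReal := by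
      rw [← ENNReal.toReal_one]; exact ENNReal.toReal_mono htop hp
    have hp0 : 0 < p.toReal := by linarith
    rw [lpNormFun, PiLp.norm_eq_sum hp0]
    have hterm : ∀ k, ‖(U.card : ℝ) ^ (-(p.toReal)⁻¹) * incidence U k‖ ^ p.toReal
        = if k ∈ U then (U.card : ℝ)⁻¹ else 0 := by
      intro k
      by_cases h : k ∈ U
      · simp only [incidence, h, if_true, mul_one, Real.norm_eq_abs]
        rw [abs_of_pos (by positivity), ← Real.rpow_mul hcard.le, neg_mul,
          inv_mul_cancel₀ hp0.ne', Real.rpow_neg_one]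
      · simp [incidence, h, Real.zero_rpow hp0.ne']
    simp only [hterm]
    simp [hcard.ne']

/-- The dual norm of `L_p` at a `0/1` vector with `k` ones, as a function of `k`. -/
noncomputable def dualLpOnes (p : ENNReal) (k : ℕ) : ℝ :=
  -- For `p = 1` the exponent is 0 and `0 ^ 0 = 1`, while the dual norm of the zero vector is 0.
  if k = 0 then 0 else (k : ℝ) ^ (1 - (p.toReal)⁻¹)

theorem dualNormFun_lpNormFun_incidence {p : ENNReal} (hp : 1 ≤ p) (U : Finset κ) :
    dualNormFun (lpNormFun p) (incidence U) = dualLpOnes p U.card := by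
  have : Fact (1 ≤ p) := ⟨hp⟩
  have hsum : ∀ y : κ → ℝ, ∑ k, incidence U k * y k = ∑ k ∈ U, y k := fun y => by
    simp [incidence]
  refine IsGreatest.csSup_eq ?_
  rcases U.eq_empty_or_nonempty with rfl | hU
  · refine ⟨⟨0, ?_, by simp [dualLpOnes]⟩, ?_⟩
    · have : lpNormFun p (0 : κ → ℝ) = 0 := by
        rw [lpNormFun, WithLp.toLp_zero, norm_zero]
      rw [this]; exact zero_le_one
    · rintro s ⟨y, -, rfl⟩
      rw [hsum]; simp [dualLpOnes]
  · have hcard : (0 : ℝ) < U.card := by exact_mod_cast hU.card_pos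
    rw [dualLpOnes, if_neg hU.card_pos.ne']
    refine ⟨⟨_, lpNormFun_smul_incidence_le hp U hU, ?_⟩, ?_⟩
    · rw [hsum, ← Finset.mul_sum]
      have : ∑ k ∈ U, incidence U k = U.card := by simp [incidence]
      rw [this, sub_eq_neg_add, Real.rpow_add_one hcard.ne']
    · rintro s ⟨y, hy, rfl⟩
      rw [hsum]
      refine (sum_le_rpow_card_mul_lpNormFun hp U y hU).trans ?_
      exact mul_le_of_le_one_right (by positivity) hy

/-- Concavity of `s ^ θ` for `θ = 1 - 1/p` in `[0, 1]`, applied at the midpoint of `k` and `k + 2`.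
-/
theorem antitone_dualLpOnes_succ_sub {p : ENNReal} (hp : 1 ≤ p) :
    Antitone fun k => dualLpOnes p (k + 1) - dualLpOnes p k := by
  have hθ : 0 ≤ 1 - (p.toReal)⁻¹ ∧ 1 - (p.toReal)⁻¹ ≤ 1 := by
    refine ⟨?_, by linarith [inv_nonneg.2 (ENNReal.toReal_nonneg (a := p))]⟩
    rcases eq_or_ne p ⊤ with rfl | htop
    · simp
    · have hp1 : 1 ≤ p.toReal := by
        rw [← ENNReal.toReal_one]; exact ENNReal.toReal_mono htop hp
      linarith [inv_le_one_of_one_le₀ hp1]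
  refine antitone_nat_of_succ_le fun k => ?_
  rcases k with _ | k
  -- The value at 0 is set separately, so the first comparison is done by hand: it reads `2 ^ θ - 1
  -- ≤ 1`.
  · have h : (2 : ℝ) ^ (1 - (p.toReal)⁻¹) ≤ 2 ^ (1 : ℝ) :=
      Real.rpow_le_rpow_of_exponent_le one_le_two hθ.2
    rw [Real.rpow_one] at h
    norm_num [dualLpOnes]
    linarith
  · have hconc := (Real.concaveOn_rpow hθ.1 hθ.2).2
    have h := hconc (x := ((k + 1 : ℕ) : ℝ))
      (Set.mem_Ici.2 (Nat.cast_nonneg _)) (y := ((k + 1 + 1 + 1 : ℕ) : ℝ))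
      (Set.mem_Ici.2 (Nat.cast_nonneg _)) (a := 1 / 2) (b := 1 / 2)
      (by norm_num) (by norm_num) (by norm_num)
    have hmid : (1 / 2 : ℝ) • ((k + 1 : ℕ) : ℝ) + (1 / 2 : ℝ) • ((k + 1 + 1 + 1 : ℕ) : ℝ)
        = ((k + 1 + 1 : ℕ) : ℝ) := by
      push_cast
      simp only [smul_eq_mul]
      ring
    rw [hmid] at h
    simp only [smul_eq_mul] at h
    simp only [dualLpOnes, Nat.add_eq_zero_iff, one_ne_zero, and_false, if_false]
    linarith

end DualNorm

/-! ### Submodularity of the slack and norm functions -/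

namespace ChanceData

variable {n I N : ℕ}

/-- The shift `e` is the contribution of `η₂`. Being independent of `T`, it only translates the
concave function of the cardinality. -/
theorem exists_a_incidence_eq (D : ChanceData n I N) (h : D.η₁ = 1) :
    ∃ e : ℕ, ∀ T : Finset (Fin n), ∃ U : Finset (Fin (n + 1)),
      D.a (incidence T) = incidence U ∧ U.card = T.card + e := by
  have hcast : ∀ T : Finset (Fin n), Fin.last n ∉ T.map Fin.castSuccEmb := by
    intro T hT
    obtain ⟨l, -, hl⟩ := Finset.mem_map.1 hT
    exact Fin.castSucc_ne_last l hl
  rcases D.η₂_binary with h2 | h2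
  · refine ⟨0, fun T => ⟨T.map Fin.castSuccEmb, ?_, by simp⟩⟩
    ext k
    refine Fin.lastCases ?_ (fun l => ?_) k
    · simp only [a, Fin.snoc_last, incidence, hcast T, if_false, h2]
    · simp [a, incidence, h]
  · refine ⟨1, fun T => ⟨insert (Fin.last n) (T.map Fin.castSuccEmb), ?_, ?_⟩⟩
    · ext k
      refine Fin.lastCases ?_ (fun l => ?_) k
      · simp [a, incidence, h2]
      · simp [a, incidence, h, Fin.castSucc_ne_last]
    · rw [Finset.card_insert_of_notMem (hcast T), Finset.card_map]

theorem submodularOnCube_normFun (D : ChanceData n I N) {p : ENNReal} (hp : 1 ≤ p) :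
    SubmodularOnCube (D.normFun (lpNormFun p)) := by
  intro T₁ T₂ hT t ht
  rcases D.η₁_binary with h | h
  · have : ∀ x y : Fin n → ℝ, D.normFun (lpNormFun p) x = D.normFun (lpNormFun p) y := by
      intro x y
      have : D.a x = D.a y := by simp [a, h]
      rw [normFun, normFun, this]
    simp only [this _ 0, sub_self, le_refl]
  · obtain ⟨e, he⟩ := D.exists_a_incidence_eq h
    have hval : ∀ T, D.normFun (lpNormFun p) (incidence T) = dualLpOnes p (T.card + e) := by
      intro T
      obtain ⟨U, hU, hc⟩ := he T
      rw [normFun, hU, dualNormFun_lpNormFun_incidence hp, hc]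
    simp only [hval, Finset.card_insert_of_notMem ht,
      Finset.card_insert_of_notMem fun h => ht (hT h), add_right_comm _ 1 e]
    exact antitone_dualLpOnes_succ_sub hp (Nat.add_le_add_right (Finset.card_le_card hT) e)

/-- Nonnegative coefficients make the weight of a set monotone under inclusion, and `-max(s + u, 0)`
is concave in `s`, so its increments over a fixed step shrink as `s` grows. -/
theorem submodularOnCube_slackFun {D : ChanceData n I N} (R : D.ComplementedForm)
    (i : Fin I) (j : Fin N) : SubmodularOnCube (slackFun R i j) := by
  intro T₁ T₂ hT t ht
  set c : Fin n ⊕ Fin n → ℝ := Sum.elim (R.r i j) (R.t i j) with hc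
  have hc0 : ∀ k, 0 ≤ c k := by
    rintro (l | l)
    exacts [R.r_nonneg i j l, R.t_nonneg i j l]
  have hval : ∀ T : Finset (Fin n ⊕ Fin n),
      slackFun R i j (incidence T) = -max (∑ k ∈ T, c k + R.u i j) 0 := by
    intro T
    have : ∑ k ∈ T, c k = ∑ k, c k * incidence T k := by simp [incidence]
    rw [this, Fintype.sum_sum_type]
    rfl
  have hmono : ∑ k ∈ T₁, c k ≤ ∑ k ∈ T₂, c k :=
    Finset.sum_le_sum_of_subset_of_nonneg hT fun k _ _ => hc0 k
  have ht0 := hc0 t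
  simp only [hval, Finset.sum_insert ht, Finset.sum_insert fun h => ht (hT h)]
  simp only [max_def]
  split_ifs <;> linarith

end ChanceData

/-! ### The reformulation and its convex hulls -/

theorem mainTheorem12 {n I N : ℕ} (D : ChanceData n I N) (R : D.ComplementedForm)
    (p : ENNReal) (hp : 1 ≤ p)
    (S : Set (Fin n → ℝ)) (hS : S ⊆ binaryCube (Fin n)) :
    -- the big-M-free representation
    (S ∩ D.Zhat₁ R (lpNormFun p) =
      {x | x ∈ S ∧ ∃ (ν γ : ℝ) (z : Fin N → ℝ) (w : Fin n → ℝ),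
        D.δ * ν - D.ε * γ ≤ (1 / (N : ℝ)) * ∑ j, z j ∧
        (∀ i j, (Sum.elim x w, -z j - γ) ∈
          convexHull ℝ (ChanceData.slackEpigraph R i j)) ∧
        (∀ j, z j ≤ 0) ∧
        (x, ν) ∈ convexHull ℝ (D.normEpigraph (lpNormFun p)) ∧
        (∀ l, w l + x l = 1) ∧
        1 ≤ ν ∧ 0 ≤ γ ∧ w ∈ unitBox (Fin n)}) ∧
    -- the functions whose epigraphs are used are submodular
    (∀ i j, SubmodularOnCube (ChanceData.slackFun R i j)) ∧
    SubmodularOnCube (D.normFun (lpNormFun p)) ∧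
    -- the convex hulls are described by the extended polymatroid inequalities
    (∀ i j, convexHull ℝ (ChanceData.slackEpigraph R i j) =
      epiPolyhedron (ChanceData.slackFun R i j)) ∧
    convexHull ℝ (D.normEpigraph (lpNormFun p)) = epiPolyhedron (D.normFun (lpNormFun p)) ∧
    -- and these inequalities are separated greedily
    (∀ i j, GreedilySeparable (ChanceData.slackFun R i j)) ∧
    GreedilySeparable (D.normFun (lpNormFun p)) := by
  have hs := fun i j => ChanceData.submodularOnCube_slackFun R i j
  have hn := D.submodularOnCube_normFun hp
  refine ⟨?_, hs, hn, fun i j => (hs i j).convexHull_eq, hn.convexHull_eq,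
    fun i j => (hs i j).greedilySeparable, hn.greedilySeparable⟩
  ext x
  refine and_congr_right fun hxS => ?_
  have hx := hS hxS
  -- The same `ν, γ, z, w` serve both formulations.
  refine exists_congr fun ν => exists_congr fun γ => exists_congr fun z => exists_congr fun w => ?_
  have hnorm := mem_convexHull_binaryEpigraph_iff (D.normFun (lpNormFun p)) hx ν
  have hslack : w ∈ binaryCube (Fin n) → ∀ i j,
      ((Sum.elim x w, -z j - γ) ∈ convexHull ℝ (ChanceData.slackEpigraph R i j) ↔
        -max (∑ l, R.r i j l * x l + ∑ l, R.t i j l * w l + R.u i j) 0 ≤ -z j - γ) :=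
    fun hw i j => mem_convexHull_binaryEpigraph_iff (ChanceData.slackFun R i j)
      (x := Sum.elim x w) (by rintro (l | l); exacts [hx l, hw l]) _
  constructor
  · rintro ⟨h1, h2, h3, h4, h5, h6, h7, h8⟩
    exact ⟨h1, fun i j => (hslack h8 i j).2 (h2 i j), h3, hnorm.2 h4, h5, h6, h7,
      binaryCube_subset_unitBox h8⟩
  · rintro ⟨h1, h2, h3, h4, h5, h6, h7, -⟩
    -- Integrality of `w` is lost in the relaxed system but recovered from `w = 1 - x`.
    have h8 : w ∈ binaryCube (Fin n) := by
      intro l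
      rcases hx l with h | h
      · right; linarith [h5 l]
      · left; linarith [h5 l]
    exact ⟨h1, fun i j => (hslack h8 i j).1 (h2 i j), h3, hnorm.1 h4, h5, h6, h7, h8⟩
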